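/- A directed graph $G$ has finite sets $V(G)$ of vertices and $E(G)$ of edges; each edge has an initial and a terminal vertex, and loops and multiple edges are allowed. A directed cycle in $G$ is a sequence $v_0,x_0,v_1,x_1,\dots,v_n,x_n,v_{n+1}=v_0$ ($n\ge 0$) with $v_0,\dots,v_n$ pairwise distinct vertices and $x_i$ an edge from $v_i$ to $v_{i+1}$; it contains the edges $x_0,\dots,x_n$. For a vertex $v$ with outgoing edges $x_1,\dots,x_m$ and incoming edges $y_1,\dots,y_r$, and for $1\le l\le k_v:=\max\{m,r\}$, put $\delta_{v,l}=e_l(x_1,\dots,x_m)-e_l(y_1,\dots,y_r)\in\mathbb Z[E(G)]$, where $e_l$ is the $l$-th elementary symmetric polynomial ($0$ if $l$ exceeds the number of variables). Let $\Delta_G=(\delta_{v,l})_{v\in V(G),\,1\le l\le k_v}$ (a family, so with multiplicity, linearly ordered in any way), and let $I(G)$ be the ideal of $\mathbb Z[E(G)]$ generated by $\Delta_G$. Let $\mathscr C_*(G)$ be the Koszul chain complex of $\Delta_G$ over $\mathbb Z[E(G)]$, $\mathscr H_*(G)$ its homology, and $\mathscr H_*^{\mathbb Q}(G)$ the homology of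 $\mathbb Q\otimes_{\mathbb Z}\mathscr C_*(G)$. For a module $M$ over a commutative ring $R$, $\operatorname{Kdim}_R M$ denotes the Krull dimension of the ring $R/\operatorname{ann}_R(M)$. **Corollary.** Let $G$ be a directed graph and $x$ an edge of $G$. The following statements are equivalent: 1. there are no directed cycles in $G$ containing $x$; 2. $\mathbb Z[x]/\operatorname{ann}_{\mathbb Z[x]}(\mathscr H_0(G))$ is a finitely generated $\mathbb Z$-module; 3. $\mathbb Z[x]/\operatorname{ann}_{\mathbb Z[x]}(\mathscr H_*(G))$ is a finitely generated $\mathbb Z$-module; 4. there is an $n\ge 1$ such that $x^n\in I(G)$; 5. $\operatorname{Kdim}_{\mathbb Z[x]}\mathscr H_0(G)=1$; 6. $\operatorname{Kdim}_{\mathbb Q[x]}\mathscr H_0^{\mathbb Q}(G)=0$. Moreover, there is a directed cycle in $G$ containing $x$ if and only if $\operatorname{Kdim}_{\mathbb Q[x]}\mathscr H_0^{\mathbb Q}(G)=\operatorname{Kdim}_{\mathbb Z[x]}\mathscr H_0(G)-1=1$. -/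

import Mathlib

open scoped DirectSum

universe u v w

/-- The module of Koszul `n`-chains on a family of elements indexed by `ι`: the free `R`-module on
the `n`-element subsets of `ι`. The subset `S` stands for the standard basis element `1_ε`, with
`ε j = 1` exactly when `j ∈ S`. -/
abbrev KoszulChain (R : Type u) (ι : Type v) (n : ℕ) : Type (max u v) :=
  {S : Finset ι // S.card = n} → R

/-- The Koszul differential
`d (1_S) = ∑_{j ∈ S} (-1) ^ #{i ∈ S | i < j} • r_j • 1_{S \ {j}}`, written in coordinates: the
coefficient of `d f` at `T` collects the contributions of the sets `S = T ∪ {j}` with `j ∉ T`. -/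
def koszulD {R : Type u} [CommRing R] {ι : Type v} [Fintype ι] [LinearOrder ι] (r : ι → R)
    (n : ℕ) : KoszulChain R ι (n + 1) →ₗ[R] KoszulChain R ι n where
  toFun f T := ∑ j : {j : ι // j ∉ T.1},
    (-1) ^ (T.1.filter (fun i => i < j.1)).card * r j.1 *
      f ⟨insert j.1 T.1, by rw [Finset.card_insert_of_notMem j.2, T.2]⟩
  map_add' f g := by
    funext T
    simp only [Pi.add_apply, mul_add, Finset.sum_add_distrib]
  map_smul' c f := by
    funext T
    simp only [Pi.smul_apply, smul_eq_mul, RingHom.id_apply, Finset.mul_sum]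
    exact Finset.sum_congr rfl fun j _ => by ring

theorem koszulD_comp_koszulD {R : Type u} [CommRing R] {ι : Type v} [Fintype ι] [LinearOrder ι]
    (r : ι → R) (n : ℕ) : koszulD r n ∘ₗ koszulD r (n + 1) = 0 := by
  refine LinearMap.ext fun f => funext fun T => ?_
  change (∑ j : {j : ι // j ∉ T.1}, (-1) ^ (T.1.filter (fun i => i < j.1)).card * r j.1 *
    ∑ k : {k : ι // k ∉ insert j.1 T.1},
      (-1) ^ ((insert j.1 T.1).filter (fun i => i < k.1)).card * r k.1 *
        f ⟨insert k.1 (insert j.1 T.1), _⟩) = 0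
  simp only [Finset.mul_sum]
  rw [Finset.sum_sigma']
  have hne : ∀ a : (j : {j : ι // j ∉ T.1}) × {k : ι // k ∉ insert j.1 T.1},
      a.2.1 ≠ a.1.1 ∧ a.2.1 ∉ T.1 := fun a => by
    have := a.2.2
    rwa [Finset.mem_insert, not_or] at this
  have hsign : ∀ j k : ι, j ∉ T.1 → ((-1 : R)) ^ ((insert j T.1).filter (fun i => i < k)).card =
      (if j < k then -1 else 1) * (-1) ^ (T.1.filter (fun i => i < k)).card := by
    intro j k hj
    rw [Finset.filter_insert]
    split_ifs with h
    · rw [Finset.card_insert_of_notMem (fun h' => hj (Finset.mem_filter.1 h').1), pow_succ']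
    · rw [one_mul]
  refine Finset.sum_involution
    (fun a _ => ⟨⟨a.2.1, (hne a).2⟩, ⟨a.1.1, by
      rw [Finset.mem_insert, not_or]
      exact ⟨(hne a).1.symm, a.1.2⟩⟩⟩) ?_ ?_ ?_ ?_
  · intro a _
    have hf : ∀ h h', f ⟨insert a.2.1 (insert a.1.1 T.1), h⟩ =
        f ⟨insert a.1.1 (insert a.2.1 T.1), h'⟩ := fun h h' =>
      congrArg f (Subtype.ext (Finset.insert_comm _ _ _))
    have hc : (insert a.1.1 (insert a.2.1 T.1)).card = n + 1 + 1 := by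
      rw [Finset.card_insert_of_notMem, Finset.card_insert_of_notMem (hne a).2, T.2]
      rw [Finset.mem_insert, not_or]
      exact ⟨(hne a).1.symm, a.1.2⟩
    rw [hsign _ _ a.1.2, hsign _ _ (hne a).2, hf _ hc]
    rcases lt_or_gt_of_ne (hne a).1 with h | h
    · rw [if_neg h.not_gt, if_pos h]
      ring
    · rw [if_pos h, if_neg h.not_gt]
      ring
  · intro a _ _ h
    exact (hne a).1 (congrArg (fun b => b.1.1) h)
  · intro a _
    exact Finset.mem_univ _
  · intro a _
    rfl

/-- The Koszul chain complex over `R` of a finite family `r` of elements of `R`. -/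
noncomputable def koszulComplex {R : Type u} [CommRing R] {ι : Type v} [Fintype ι] [LinearOrder ι]
    (r : ι → R) : ChainComplex (ModuleCat.{max u v} R) ℕ :=
  ChainComplex.of (fun n => ModuleCat.of R (KoszulChain R ι n))
    (fun n => ModuleCat.ofHom (koszulD r n))
    (fun n => by
      rw [← ModuleCat.ofHom_comp, koszulD_comp_koszulD]
      rfl)

instance extendScalars_additive {R S : Type v} [CommRing R] [CommRing S] (f : R →+* S) :
    (ModuleCat.extendScalars.{v, v, w} f).Additive where
  map_add {M N g h} := by
    refine ModuleCat.ExtendScalars.hom_ext fun m => ?_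
    let := f.toAlgebra
    exact TensorProduct.tmul_add (R := R) (M := S) (1 : S) (g m) (h m)

/-- A directed graph with vertex set `V` and edge set `E`; loops and multiple edges are allowed. -/
structure DirectedGraph (V : Type u) (E : Type v) where
  /-- the initial vertex of an edge -/
  init : E → V
  /-- the terminal vertex of an edge -/
  term : E → V

/-- A directed cycle: distinct vertices `v_0, …, v_n` and edges `x_0, …, x_n`, where `x_i` goes
from `v_i` to `v_{i+1}` and `v_{n+1} = v_0` (addition in `Fin (n + 1)` is cyclic). -/
structure DirectedGraph.Cycle {V : Type u} {E : Type v} (G : DirectedGraph V E) where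
  n : ℕ
  vertex : Fin (n + 1) → V
  edge : Fin (n + 1) → E
  vertex_injective : Function.Injective vertex
  init_edge : ∀ i, G.init (edge i) = vertex i
  term_edge : ∀ i, G.term (edge i) = vertex (i + 1)

/-- There is a directed cycle in `G` that contains the edge `x`. -/
def DirectedGraph.HasCycleThrough {V : Type u} {E : Type v} (G : DirectedGraph V E) (x : E) :
    Prop :=
  ∃ C : G.Cycle, ∃ i, C.edge i = x

/-- The `l`-th elementary symmetric polynomial in the variables of the finite set `S`. -/
noncomputable def esymmOn {E : Type v} (S : Finset E) (l : ℕ) : MvPolynomial E ℤ :=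
  ∑ T ∈ S.powersetCard l, ∏ e ∈ T, MvPolynomial.X e

namespace DirectedGraph

variable {V : Type u} {E : Type v} [DecidableEq V] [Fintype E] (G : DirectedGraph V E)

/-- The edges with initial vertex `v`. -/
def outEdges (v : V) : Finset E := Finset.univ.filter (fun e => G.init e = v)

/-- The edges with terminal vertex `v`. -/
def inEdges (v : V) : Finset E := Finset.univ.filter (fun e => G.term e = v)

/-- `k_v`, the maximum of the out-degree and the in-degree of `v`. -/
def maxDegree (v : V) : ℕ := max (G.outEdges v).card (G.inEdges v).card

/-- The incidence relation `δ_{v,l} = e_l(x_1, …, x_m) - e_l(y_1, …, y_n)` at `v`, where the `x_i`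
are the edges leaving `v` and the `y_j` are the edges entering `v`. -/
noncomputable def incidenceRelation (v : V) (l : ℕ) : MvPolynomial E ℤ :=
  esymmOn (G.outEdges v) l - esymmOn (G.inEdges v) l

/-- The index set of the family `Δ_G`: the pairs `(v, l)` with `1 ≤ l ≤ k_v`. The pair `(v, l)` is
represented by `⟨v, l - 1⟩`. -/
def RelationIndex : Type u := Σ v : V, Fin (G.maxDegree v)

instance [Fintype V] : Fintype G.RelationIndex :=
  inferInstanceAs (Fintype (Σ v : V, Fin (G.maxDegree v)))

/-- The family `Δ_G` of all incidence relations of `G`. -/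
noncomputable def relations (i : G.RelationIndex) : MvPolynomial E ℤ :=
  G.incidenceRelation i.1 (i.2.1 + 1)

/-- The incidence ideal `I(G)`. -/
noncomputable def incidenceIdeal : Ideal (MvPolynomial E ℤ) :=
  Ideal.span (Set.range G.relations)

variable [Fintype V] [LinearOrder G.RelationIndex]

/-- The Khovanov-Rozansky chain complex of `G`: the Koszul complex of `Δ_G` over `ℤ[E(G)]`, for the
given linear order of `Δ_G`. -/
noncomputable def KRComplex : ChainComplex (ModuleCat.{max u v} (MvPolynomial E ℤ)) ℕ :=
  koszulComplex G.relations

/-- The Khovanov-Rozansky homology of `G` in homological degree `n`. -/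
noncomputable abbrev KRHomology (n : ℕ) : ModuleCat.{max u v} (MvPolynomial E ℤ) :=
  G.KRComplex.homology n

/-- The total Khovanov-Rozansky homology of `G`. -/
abbrev TotalKRHomology : Type (max u v) := ⨁ n, G.KRHomology n

/-- The Khovanov-Rozansky chain complex over `ℚ`, that is, `ℚ ⊗_ℤ -` of the integral complex. It is
a complex of modules over `ℚ[E(G)] = ℚ ⊗_ℤ ℤ[E(G)]`, and is obtained as
`ℚ[E(G)] ⊗_{ℤ[E(G)]} -`. -/
noncomputable def KRComplexRat : ChainComplex (ModuleCat.{max u v} (MvPolynomial E ℚ)) ℕ :=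
  ((ModuleCat.extendScalars.{v, v, max u v}
    (MvPolynomial.map (σ := E) (Int.castRingHom ℚ))).mapHomologicalComplex _).obj G.KRComplex

/-- The zeroth Khovanov-Rozansky homology of `G` over `ℚ`. -/
noncomputable abbrev KRHomologyRatZero : ModuleCat.{max u v} (MvPolynomial E ℚ) :=
  G.KRComplexRat.homology 0

end DirectedGraph

/-- The inclusion of the subring `k[x]`, generated by the single variable `x`, into the polynomial
ring `k[E]`. -/
noncomputable def edgeInclusion (k : Type w) [CommRing k] {E : Type v} (x : E) :
    Polynomial k →+* MvPolynomial E k :=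
  (Polynomial.aeval (MvPolynomial.X x : MvPolynomial E k)).toRingHom

/-- The annihilator `ann_A(M) = {a ∈ A | a m = 0 for all m ∈ M}` of an `R`-module `M`, regarded as
an `A`-module through a ring homomorphism `φ : A → R`. -/
def annOver {A : Type u} {R : Type v} [CommRing A] [CommRing R] (φ : A →+* R) (M : Type w)
    [AddCommGroup M] [Module R M] : Ideal A where
  carrier := {a | ∀ m : M, φ a • m = 0}
  add_mem' ha hb m := by rw [map_add, add_smul, ha m, hb m, add_zero]
  zero_mem' m := by rw [map_zero, zero_smul]
  smul_mem' c a ha m := by rw [smul_eq_mul, map_mul, mul_smul, ha m, smul_zero]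

/-- The Krull dimension `Kdim_A M = Kdim (A / ann_A(M))` of an `R`-module `M`, regarded as an
`A`-module through a ring homomorphism `φ : A → R`. -/
noncomputable def KdimOver {A : Type u} {R : Type v} [CommRing A] [CommRing R] (φ : A →+* R)
    (M : Type w) [AddCommGroup M] [Module R M] : WithBot ℕ∞ :=
  ringKrullDim (A ⧸ annOver φ M)

/-!
A finite set of edges is *balanced* if it leaves and enters every vertex equally often; `x` lies on
a directed cycle if and only if it lies in a balanced set. Putting the edges of a balanced set equal
to `c` and all others equal to `0` solves every incidence relation. Conversely, collect the
relations at `v` into the identity `∏ (1 + xᵢ t) = ∏ (1 + yⱼ t)`: for a solution in a domain, unique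
factorization shows that the edges with a given nonzero value form a balanced set. Hence the ideal
of `k[x]` cut out by `I(G)` is `0` if `x` lies on a directed cycle, and otherwise it is contained in
`(x)` and contains a power of `x`. All annihilators in the theorem are such ideals, because the
homology of a Koszul complex is annihilated by the elements of its family, and in degree `0` it is
the quotient by the ideal that they generate.
-/

/-- A finite set of edges is balanced if it leaves and enters every vertex equally often, that is,
if it is a circulation with values in `{0, 1}`. This is encoded as the equality of the multiset of
initial vertices and the multiset of terminal vertices. -/
def DirectedGraph.IsBalanced {V : Type u} {E : Type v} (G : DirectedGraph V E) (F : Finset E) :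
    Prop :=
  F.val.map G.init = F.val.map G.term

section Walks

variable {α : Type*} {r : SetRel α α}

theorem exists_relSeries_injective_of_reflTransGen {a b : α}
    (h : Relation.ReflTransGen (fun c d => (c, d) ∈ r) a b) :
    ∃ p : RelSeries r, Function.Injective p ∧ p.head = a ∧ p.last = b := by
  induction h using Relation.ReflTransGen.head_induction_on with
  | refl => exact ⟨.singleton r b, Function.injective_of_subsingleton (α := Fin 1) _, rfl, rfl⟩
  | @head a c hac _ ih =>
    obtain ⟨p, hp, rfl, rfl⟩ := ih
    by_cases ha : a ∈ p
    · obtain ⟨i, rfl⟩ := ha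
      refine ⟨p.drop i, fun j k hjk => ?_, p.head_drop i, p.last_drop i⟩
      exact Fin.ext (Nat.add_right_cancel (congrArg Fin.val (hp hjk)))
    · refine ⟨p.cons a hac, ?_, p.head_cons a hac, p.last_cons a hac⟩
      rw [← List.nodup_ofFn, ← RelSeries.toList, p.toList_cons, List.nodup_cons,
        RelSeries.mem_toList]
      exact ⟨ha, List.nodup_ofFn.2 hp⟩

end Walks

namespace DirectedGraph

variable {V : Type u} {E : Type v} {G : DirectedGraph V E}

theorem hasCycleThrough_of_reflTransGen {x : E}
    (h : Relation.ReflTransGen (fun v w => ∃ e, G.init e = v ∧ G.term e = w)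
      (G.term x) (G.init x)) : G.HasCycleThrough x := by
  obtain ⟨p, hp, hhead, hlast⟩ := exists_relSeries_injective_of_reflTransGen
    (r := {q | ∃ e, G.init e = q.1 ∧ G.term e = q.2}) h
  choose edge hinit hterm using p.step
  refine ⟨⟨p.length, p, Fin.lastCases x edge, hp, fun i => ?_, fun i => ?_⟩, Fin.last _, by simp⟩
  · cases i using Fin.lastCases with
    | last => simpa using hlast.symm.trans p.apply_last.symm
    | cast i => simpa using hinit i
  · cases i using Fin.lastCases with
    | last => simpa using hhead.symm.trans p.apply_zero.symm
    | cast i => simpa using hterm i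

theorem IsBalanced.card_filter_init_eq_card_filter_term {F : Finset E} (hF : G.IsBalanced F)
    (P : V → Prop) [DecidablePred P] :
    (F.filter fun e => P (G.init e)).card = (F.filter fun e => P (G.term e)).card := by
  have h := congrArg (Multiset.countP P) hF
  rwa [Multiset.countP_map, Multiset.countP_map] at h

/-- The vertices reachable from `G.term x` inside `F` form a set that no edge of `F` leaves, so by
balance no edge of `F` enters it from outside; hence it contains `G.init x`. -/
theorem IsBalanced.hasCycleThrough {F : Finset E} (hF : G.IsBalanced F) {x : E} (hx : x ∈ F) :
    G.HasCycleThrough x := by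
  classical
  let Reachable : V → Prop :=
    Relation.ReflTransGen (fun v w => ∃ e, G.init e = v ∧ G.term e = w) (G.term x)
  have hsub : (F.filter fun e => Reachable (G.init e)) ⊆ F.filter fun e => Reachable (G.term e) :=
    Finset.monotone_filter_right _ fun e _ he => he.tail ⟨e, rfl, rfl⟩
  have heq := Finset.eq_of_subset_of_card_le hsub
    (hF.card_filter_init_eq_card_filter_term Reachable).ge
  have hxterm : x ∈ F.filter fun e => Reachable (G.term e) :=
    Finset.mem_filter.2 ⟨hx, Relation.ReflTransGen.refl⟩
  rw [← heq] at hxterm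
  exact hasCycleThrough_of_reflTransGen (Finset.mem_filter.1 hxterm).2

theorem isBalanced_empty : G.IsBalanced ∅ := rfl

theorem Cycle.edge_injective (C : G.Cycle) : Function.Injective C.edge := fun i j h =>
  C.vertex_injective (by rw [← C.init_edge, ← C.init_edge, h])

theorem Cycle.isBalanced_map_edge (C : G.Cycle) :
    G.IsBalanced (Finset.univ.map ⟨C.edge, C.edge_injective⟩) := by
  have hshift := congrArg (Multiset.map C.vertex)
    (Multiset.map_univ_val_equiv (Equiv.addRight (1 : Fin (C.n + 1))))
  simp only [Multiset.map_map] at hshift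
  simpa [IsBalanced, Multiset.map_map, Function.comp_def, C.init_edge, C.term_edge]
    using hshift.symm

theorem hasCycleThrough_iff_exists_isBalanced {x : E} :
    G.HasCycleThrough x ↔ ∃ F, G.IsBalanced F ∧ x ∈ F := by
  refine ⟨?_, fun ⟨F, hF, hx⟩ => hF.hasCycleThrough hx⟩
  rintro ⟨C, i, rfl⟩
  exact ⟨_, C.isBalanced_map_edge, Finset.mem_map_of_mem _ (Finset.mem_univ i)⟩

theorem isBalanced_iff_card [DecidableEq V] [Fintype E] {F : Finset E} [DecidablePred (· ∈ F)] :
    G.IsBalanced F ↔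
      ∀ v, ((G.outEdges v).filter (· ∈ F)).card = ((G.inEdges v).filter (· ∈ F)).card := by
  classical
  have hcount (f : E → V) (v : V) :
      (F.val.map f).count v = ((Finset.univ.filter fun e => f e = v).filter (· ∈ F)).card := by
    rw [Multiset.count_map, ← Finset.filter_val, Finset.card_val]
    congr 1
    ext e
    simp only [Finset.mem_filter, Finset.mem_univ, true_and, eq_comm, and_comm]
  simp only [IsBalanced, Multiset.ext, hcount, outEdges, inEdges]

end DirectedGraph

section GeneratingPolynomial

open Polynomial

variable {ι : Type*} {D : Type*} [CommRing D]

theorem coeff_prod_one_add_C_mul_X (a : ι → D) (S : Finset ι) (l : ℕ) :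
    (∏ e ∈ S, (1 + C (a e) * X)).coeff l = ∑ T ∈ S.powersetCard l, ∏ e ∈ T, a e := by
  simp only [Finset.prod_one_add, Finset.prod_mul_distrib, Finset.prod_const, ← map_prod,
    finsetSum_coeff, coeff_C_mul_X_pow, ← Finset.sum_filter, Finset.powersetCard_eq_filter,
    eq_comm]

variable [IsDomain D]

/-- Reversal turns the factors `1 + c X` with `c ≠ 0` into `X + c`, and the others into `1`. -/
theorem reverse_prod_one_add_C_mul_X [DecidableEq D] (a : ι → D) (S : Finset ι) :
    (∏ e ∈ S, (1 + C (a e) * X)).reverse = ∏ e ∈ S with a e ≠ 0, (X - C (-a e)) := by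
  classical
  have hone : (1 : D[X]).reverse = 1 := by rw [← C_1, reverse_C]
  have hfactor (c : D) : (1 + C c * X).reverse = if c ≠ 0 then X - C (-c) else 1 := by
    split_ifs with hc
    · rw [← C_1, reverse_C_add, reverse_mul_X, reverse_C, natDegree_C_mul_X c hc, C_neg, C_1]
      ring
    · rw [not_not.1 hc, C_0, zero_mul, add_zero, hone]
  rw [Finset.prod_filter]
  induction S using Finset.induction_on with
  | empty => simpa using hone
  | insert e S he ih => rw [Finset.prod_insert he, Finset.prod_insert he, reverse_mul_of_domain,
      hfactor, ih]

theorem card_filter_eq_of_prod_one_add_C_mul_X_eq [DecidableEq D] {a : ι → D} {S T : Finset ι}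
    (h : ∏ e ∈ S, (1 + C (a e) * X) = ∏ e ∈ T, (1 + C (a e) * X)) {c : D} (hc : c ≠ 0) :
    (S.filter fun e => a e = c).card = (T.filter fun e => a e = c).card := by
  have hcount (S : Finset ι) :
      (∏ e ∈ S, (1 + C (a e) * X)).reverse.roots.count (-c) =
        (S.filter fun e => a e = c).card := by
    have hroots : (∏ e ∈ S with a e ≠ 0, (X - C (-a e))).roots =
        (S.filter fun e => a e ≠ 0).val.map fun e => -a e := by
      rw [← roots_multiset_prod_X_sub_C (Multiset.map _ _), Multiset.map_map]
      rfl
    rw [reverse_prod_one_add_C_mul_X, hroots, Multiset.count_map, ← Finset.filter_val,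
      Finset.card_val, Finset.filter_filter]
    congr 1
    ext e
    simp only [Finset.mem_filter, neg_inj, eq_comm (a := c), and_congr_right_iff,
      and_iff_right_iff_imp]
    rintro - rfl
    exact hc
  rw [← hcount, ← hcount, h]

end GeneratingPolynomial

section IncidenceIdeal

open Polynomial

theorem map_esymmOn {E : Type v} {D : Type*} [CommRing D] (φ : MvPolynomial E ℤ →+* D)
    (S : Finset E) (l : ℕ) :
    φ (esymmOn S l) = (∏ e ∈ S, (1 + C (φ (.X e)) * X)).coeff l := by
  simp only [coeff_prod_one_add_C_mul_X, esymmOn, map_sum, map_prod]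

namespace DirectedGraph

variable {V : Type u} {E : Type v} [DecidableEq V] [Fintype E] {G : DirectedGraph V E}
variable {D : Type*} [CommRing D] {φ : MvPolynomial E ℤ →+* D}

theorem incidenceIdeal_le_ker_iff :
    G.incidenceIdeal ≤ RingHom.ker φ ↔ ∀ v,
      ∏ e ∈ G.outEdges v, (1 + C (φ (.X e)) * X) = ∏ e ∈ G.inEdges v, (1 + C (φ (.X e)) * X) := by
  have hrel (v : V) (l : ℕ) : φ (G.incidenceRelation v l) = 0 ↔
      (∏ e ∈ G.outEdges v, (1 + C (φ (.X e)) * X)).coeff l =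
        (∏ e ∈ G.inEdges v, (1 + C (φ (.X e)) * X)).coeff l := by
    rw [incidenceRelation, map_sub, map_esymmOn, map_esymmOn, sub_eq_zero]
  rw [incidenceIdeal, Ideal.span_le, Set.range_subset_iff]
  refine ⟨fun h v => Polynomial.ext fun l => ?_, fun h i => (hrel _ _).2 (by rw [h])⟩
  rcases l.eq_zero_or_pos with rfl | hpos
  · simp only [coeff_prod_one_add_C_mul_X, Finset.powersetCard_zero, Finset.sum_singleton]
  rcases lt_or_ge (G.maxDegree v) l with hlt | hle
  · have hout : (G.outEdges v).card < l := (le_max_left _ _).trans_lt hlt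
    have hin : (G.inEdges v).card < l := (le_max_right _ _).trans_lt hlt
    rw [coeff_prod_one_add_C_mul_X, coeff_prod_one_add_C_mul_X,
      Finset.powersetCard_eq_empty.2 hout, Finset.powersetCard_eq_empty.2 hin]
  · obtain ⟨m, rfl⟩ := Nat.exists_eq_add_of_lt hpos
    rw [← hrel]
    simpa [relations] using h ⟨v, m, by lia⟩

/-- Both sides of `incidenceIdeal_le_ker_iff` are `(1 + c X) ^ m`, where `m` is the number of edges
of `F` that leave, respectively enter, the vertex. -/
theorem IsBalanced.incidenceIdeal_le_ker {F : Finset E} [DecidablePred (· ∈ F)]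
    (hF : G.IsBalanced F) {c : D} (hφ : ∀ e, φ (.X e) = if e ∈ F then c else 0) :
    G.incidenceIdeal ≤ RingHom.ker φ := by
  refine incidenceIdeal_le_ker_iff.2 fun v => ?_
  have hprod (S : Finset E) : ∏ e ∈ S, (1 + C (φ (.X e)) * X) =
      (1 + C c * X) ^ (S.filter (· ∈ F)).card := by
    simp only [hφ, apply_ite C, ite_mul, add_ite, C_0, zero_mul, add_zero, Finset.prod_ite,
      Finset.prod_const, one_pow, mul_one]
  rw [hprod, hprod, isBalanced_iff_card.1 hF]

theorem isBalanced_filter_of_incidenceIdeal_le_ker [IsDomain D] [DecidableEq D]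
    (h : G.incidenceIdeal ≤ RingHom.ker φ) {c : D} (hc : c ≠ 0) :
    G.IsBalanced (Finset.univ.filter fun e => φ (.X e) = c) := by
  classical
  refine isBalanced_iff_card.2 fun v => ?_
  simpa only [Finset.mem_filter, Finset.mem_univ, true_and] using
    card_filter_eq_of_prod_one_add_C_mul_X_eq (incidenceIdeal_le_ker_iff.1 h v) hc

theorem hasCycleThrough_of_incidenceIdeal_le_ker [IsDomain D]
    (h : G.incidenceIdeal ≤ RingHom.ker φ) {x : E} (hx : φ (.X x) ≠ 0) :
    G.HasCycleThrough x := by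
  classical
  exact (isBalanced_filter_of_incidenceIdeal_le_ker h hx).hasCycleThrough
    (Finset.mem_filter.2 ⟨Finset.mem_univ x, rfl⟩)

theorem X_mem_radical_incidenceIdeal {x : E} (hx : ¬ G.HasCycleThrough x) :
    (MvPolynomial.X x : MvPolynomial E ℤ) ∈ G.incidenceIdeal.radical := by
  rw [Ideal.radical_eq_sInf, Ideal.mem_sInf]
  rintro P ⟨hP, hPprime⟩
  by_contra hxP
  refine hx (hasCycleThrough_of_incidenceIdeal_le_ker (φ := Ideal.Quotient.mk P) ?_ ?_)
  · rwa [Ideal.mk_ker]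
  · rwa [Ne, Ideal.Quotient.eq_zero_iff_mem]

end DirectedGraph

end IncidenceIdeal

section ContractedIdeal

open Polynomial

namespace DirectedGraph

variable {V : Type u} {E : Type v} [DecidableEq V] [Fintype E] (G : DirectedGraph V E)

/-- The contraction to `k[x]` of the ideal of `k[E(G)]` generated by the incidence relations. -/
noncomputable def contractedIdeal (k : Type w) [CommRing k] (x : E) : Ideal k[X] :=
  (G.incidenceIdeal.map (MvPolynomial.map (Int.castRingHom k))).comap (edgeInclusion k x)

variable {G} {k : Type w} [CommRing k] {x : E}

variable (G x) in
theorem contractedIdeal_int :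
    G.contractedIdeal ℤ x = G.incidenceIdeal.comap (edgeInclusion ℤ x) := by
  have hid : MvPolynomial.map (σ := E) (Int.castRingHom ℤ) = RingHom.id _ :=
    RingHom.ext MvPolynomial.map_id
  rw [contractedIdeal, hid, Ideal.map_id]

theorem X_pow_mem_contractedIdeal_int {n : ℕ} :
    (X : ℤ[X]) ^ n ∈ G.contractedIdeal ℤ x ↔
      (MvPolynomial.X x : MvPolynomial E ℤ) ^ n ∈ G.incidenceIdeal := by
  simp [contractedIdeal_int, edgeInclusion]

variable (k) in
theorem exists_X_pow_mem_contractedIdeal (hx : ¬ G.HasCycleThrough x) :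
    ∃ n, 1 ≤ n ∧ (X : k[X]) ^ n ∈ G.contractedIdeal k x := by
  obtain ⟨n, hn⟩ := X_mem_radical_incidenceIdeal hx
  refine ⟨n + 1, n.succ_pos, ?_⟩
  simpa [contractedIdeal, edgeInclusion, pow_succ] using
    Ideal.mem_map_of_mem (MvPolynomial.map (Int.castRingHom k)) (Ideal.mul_mem_right (.X x) _ hn)

/-- Putting the edges of `F` equal to `c` and all other edges equal to `0` solves the incidence
relations. -/
theorem IsBalanced.aeval_eq_zero {F : Finset E} [DecidablePred (· ∈ F)] (hF : G.IsBalanced F)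
    {A : Type*} [CommRing A] [Algebra k A] (c : A) {p : k[X]} (hp : p ∈ G.contractedIdeal k x) :
    aeval (if x ∈ F then c else 0) p = 0 := by
  let ψ : MvPolynomial E k →ₐ[k] A := MvPolynomial.aeval fun e => if e ∈ F then c else 0
  have hle : G.incidenceIdeal.map (MvPolynomial.map (Int.castRingHom k)) ≤ RingHom.ker ψ := by
    rw [Ideal.map_le_iff_le_comap]
    exact hF.incidenceIdeal_le_ker (φ := ψ.toRingHom.comp (MvPolynomial.map _)) (c := c)
      (by simp [ψ])
  have hψ : ψ (aeval (.X x) p) = 0 := hle hp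
  rwa [← aeval_algHom_apply, MvPolynomial.aeval_X] at hψ

theorem contractedIdeal_eq_bot (hx : G.HasCycleThrough x) : G.contractedIdeal k x = ⊥ := by
  classical
  obtain ⟨F, hF, hxF⟩ := hasCycleThrough_iff_exists_isBalanced.1 hx
  refine (Submodule.eq_bot_iff _).2 fun p hp => ?_
  simpa [hxF] using hF.aeval_eq_zero (X : k[X]) hp

theorem contractedIdeal_le_span_X : G.contractedIdeal k x ≤ Ideal.span {X} := by
  classical
  intro p hp
  rw [Ideal.mem_span_singleton, X_dvd_iff, coeff_zero_eq_aeval_zero]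
  simpa using isBalanced_empty.aeval_eq_zero (0 : k) hp

theorem exists_X_pow_mem_contractedIdeal_iff [Nontrivial k] :
    (∃ n, 1 ≤ n ∧ (X : k[X]) ^ n ∈ G.contractedIdeal k x) ↔ ¬ G.HasCycleThrough x := by
  refine ⟨fun ⟨n, _, hn⟩ hx => ?_, exists_X_pow_mem_contractedIdeal k⟩
  rw [contractedIdeal_eq_bot hx, Ideal.mem_bot] at hn
  exact (monic_X_pow n).ne_zero hn

theorem finite_quotient_contractedIdeal_iff [Nontrivial k] :
    Module.Finite k (k[X] ⧸ G.contractedIdeal k x) ↔ ¬ G.HasCycleThrough x := by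
  refine ⟨fun hfin hx => ?_, fun hx => ?_⟩
  · rw [contractedIdeal_eq_bot hx] at hfin
    exact Polynomial.not_finite (R := k) (hfin.equiv (AlgEquiv.quotientBot k k[X]).toLinearEquiv)
  · obtain ⟨n, -, hn⟩ := exists_X_pow_mem_contractedIdeal k hx
    have hfin : Module.Finite k (k[X] ⧸ Ideal.span {(X : k[X]) ^ n}) :=
      (monic_X_pow n).finite_adjoinRoot
    have hle := (Ideal.span_singleton_le_iff_mem _).2 hn
    exact Module.Finite.of_surjective (Ideal.Quotient.factorₐ k hle).toLinearMap
      (Ideal.Quotient.factor_surjective hle)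

variable (k) in
theorem ringKrullDim_quotient_contractedIdeal_of_hasCycleThrough [IsNoetherianRing k]
    (hx : G.HasCycleThrough x) :
    ringKrullDim (k[X] ⧸ G.contractedIdeal k x) = ringKrullDim k + 1 := by
  rw [contractedIdeal_eq_bot hx, ringKrullDim_eq_of_ringEquiv (RingEquiv.quotientBot k[X]),
    ringKrullDim_of_isNoetherianRing]

variable (k) in
theorem ringKrullDim_quotient_contractedIdeal_of_not_hasCycleThrough (hx : ¬ G.HasCycleThrough x) :
    ringKrullDim (k[X] ⧸ G.contractedIdeal k x) = ringKrullDim k := by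
  obtain ⟨n, -, hn⟩ := exists_X_pow_mem_contractedIdeal k hx
  have hlocus : PrimeSpectrum.zeroLocus (G.contractedIdeal k x : Set k[X]) =
      PrimeSpectrum.zeroLocus (Ideal.span {(X : k[X])} : Set k[X]) := by
    refine (PrimeSpectrum.zeroLocus_anti_mono contractedIdeal_le_span_X).antisymm' fun P hP => ?_
    rw [PrimeSpectrum.zeroLocus_span, PrimeSpectrum.mem_zeroLocus, Set.singleton_subset_iff]
    exact P.2.mem_of_pow_mem n (hP hn)
  rw [ringKrullDim_quotient, hlocus, ← ringKrullDim_quotient]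
  have e := quotientSpanXSubCAlgEquiv (0 : k)
  rw [C_0, sub_zero] at e
  exact ringKrullDim_eq_of_ringEquiv e.toRingEquiv

end DirectedGraph

end ContractedIdeal

section KoszulHomotopy

/-- The sign `(-1) ^ #{i ∈ T | i < k}` with which the Koszul differential removes `k` from
`T ∪ {k}`. -/
def koszulSign (R : Type u) [CommRing R] {ι : Type v} [LinearOrder ι] (T : Finset ι) (k : ι) : R :=
  (-1) ^ (T.filter (· < k)).card

variable {R : Type u} [CommRing R] {ι : Type v} [LinearOrder ι]

theorem koszulSign_mul_self (T : Finset ι) (k : ι) : koszulSign R T k * koszulSign R T k = 1 := by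
  rw [koszulSign, ← mul_pow, neg_one_mul, neg_neg, one_pow]

theorem koszulSign_insert {T : Finset ι} {j : ι} (hj : j ∉ T) (k : ι) :
    koszulSign R (insert j T) k = (if j < k then -1 else 1) * koszulSign R T k := by
  rw [koszulSign, Finset.filter_insert]
  split_ifs with h
  · rw [Finset.card_insert_of_notMem fun h' => hj (Finset.mem_filter.1 h').1, pow_succ']
    rfl
  · rw [one_mul, koszulSign]

theorem koszulSign_insert_self {T : Finset ι} {j : ι} (hj : j ∉ T) :
    koszulSign R (insert j T) j = koszulSign R T j := by
  rw [koszulSign_insert hj, if_neg (lt_irrefl j), one_mul]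

theorem koszulSign_insert_mul_koszulSign_insert {T : Finset ι} {j k : ι} (hj : j ∉ T)
    (hk : k ∉ T) (hjk : j ≠ k) :
    koszulSign R (insert j T) k * koszulSign R (insert k T) j =
      -(koszulSign R T j * koszulSign R T k) := by
  rw [koszulSign_insert hj, koszulSign_insert hk]
  rcases lt_or_gt_of_ne hjk with h | h
  · rw [if_pos h, if_neg h.not_gt]
    ring
  · rw [if_pos h, if_neg h.not_gt]
    ring

variable (R) in
/-- Left exterior multiplication by the basis vector `1_{j}` on functions on the finite subsets of
`ι`, the coordinates of the exterior algebra. -/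
def koszulWedge (j : ι) : (Finset ι → R) →ₗ[R] (Finset ι → R) where
  toFun F S := if j ∈ S then koszulSign R S j * F (S.erase j) else 0
  map_add' F F' := by
    funext S
    simp only [Pi.add_apply, mul_add]
    split_ifs <;> simp
  map_smul' c F := by
    funext S
    simp only [Pi.smul_apply, smul_eq_mul, RingHom.id_apply, mul_ite, mul_zero, mul_left_comm]

theorem koszulWedge_apply_insert {j : ι} {T : Finset ι} (hj : j ∉ T) (F : Finset ι → R) :
    koszulWedge R j F (insert j T) = koszulSign R T j * F T := by
  simp only [koszulWedge, LinearMap.coe_mk, AddHom.coe_mk, Finset.mem_insert_self, if_true,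
    koszulSign_insert_self hj, Finset.erase_insert hj]

theorem koszulWedge_apply_of_notMem {j : ι} {T : Finset ι} (hj : j ∉ T) (F : Finset ι → R) :
    koszulWedge R j F T = 0 :=
  if_neg hj

variable [Fintype ι]

/-- The Koszul differential of all degrees at once, on functions on the finite subsets of `ι`. -/
def totalKoszulD (r : ι → R) : (Finset ι → R) →ₗ[R] (Finset ι → R) where
  toFun F T := ∑ k ∈ Tᶜ, koszulSign R T k * r k * F (insert k T)
  map_add' F F' := by
    funext T
    simp only [Pi.add_apply, mul_add, Finset.sum_add_distrib]
  map_smul' c F := by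
    funext T
    simp only [Pi.smul_apply, smul_eq_mul, RingHom.id_apply, Finset.mul_sum, mul_left_comm]

/-- Exterior multiplication by `1_{j}` is a contracting homotopy of the Koszul complex, up to the
factor `r j`: in the sum over `k`, the terms with `k ≠ j` cancel in pairs. -/
theorem totalKoszulD_koszulWedge_add_koszulWedge_totalKoszulD (r : ι → R) (j : ι)
    (F : Finset ι → R) :
    totalKoszulD r (koszulWedge R j F) + koszulWedge R j (totalKoszulD r F) = r j • F := by
  funext T
  change ∑ k ∈ Tᶜ, koszulSign R T k * r k * koszulWedge R j F (insert k T) +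
    koszulWedge R j (totalKoszulD r F) T = r j * F T
  by_cases hjT : j ∈ T
  · obtain ⟨U, hj, rfl⟩ : ∃ U, j ∉ U ∧ insert j U = T :=
      ⟨T.erase j, Finset.notMem_erase j T, Finset.insert_erase hjT⟩
    have hU : Uᶜ = insert j (insert j U)ᶜ := by
      rw [Finset.compl_insert, Finset.insert_erase (Finset.mem_compl.2 hj)]
    have hcancel : ∀ k ∈ (insert j U)ᶜ,
        koszulSign R (insert j U) k * r k * koszulWedge R j F (insert k (insert j U)) =
          -(koszulSign R U j * (koszulSign R U k * r k * F (insert k U))) := by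
      intro k hk
      obtain ⟨hkj, hkU⟩ : k ≠ j ∧ k ∉ U := by simpa using hk
      rw [Finset.insert_comm, koszulWedge_apply_insert (by simp [hkj.symm, hj])]
      linear_combination r k * F (insert k U) *
        koszulSign_insert_mul_koszulSign_insert (R := R) hj hkU hkj.symm
    rw [koszulWedge_apply_insert hj, Finset.sum_congr rfl hcancel, Finset.sum_neg_distrib]
    change _ + koszulSign R U j * ∑ k ∈ Uᶜ, koszulSign R U k * r k * F (insert k U) = _
    rw [hU, Finset.sum_insert (by simp), mul_add, ← Finset.mul_sum]
    linear_combination r j * F (insert j U) * koszulSign_mul_self (R := R) U j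
  · rw [koszulWedge_apply_of_notMem hjT, add_zero, Finset.sum_eq_single j]
    · rw [koszulWedge_apply_insert hjT]
      linear_combination r j * F T * koszulSign_mul_self (R := R) T j
    · intro k _ hkj
      rw [koszulWedge_apply_of_notMem (by simp [hjT, Ne.symm hkj]), mul_zero]
    · exact fun h => absurd (Finset.mem_compl.2 hjT) h

/-- The restriction of a function on the finite subsets of `ι` to the `n`-element subsets. -/
def koszulRestrict (R : Type u) [CommRing R] (ι : Type v) (n : ℕ) :
    (Finset ι → R) →ₗ[R] KoszulChain R ι n :=
  LinearMap.funLeft R R Subtype.val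

/-- The extension by zero of a Koszul `n`-chain to a function on all finite subsets of `ι`. -/
noncomputable def koszulExtend (R : Type u) [CommRing R] (ι : Type v) (n : ℕ) :
    KoszulChain R ι n →ₗ[R] (Finset ι → R) :=
  Function.ExtendByZero.linearMap R Subtype.val

theorem koszulRestrict_koszulExtend {R : Type u} [CommRing R] {ι : Type v} {n : ℕ}
    (f : KoszulChain R ι n) : koszulRestrict R ι n (koszulExtend R ι n f) = f :=
  funext fun S => Subtype.val_injective.extend_apply f 0 S

theorem koszulExtend_apply_of_card_ne {R : Type u} [CommRing R] {ι : Type v} {n : ℕ}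
    (f : KoszulChain R ι n) {S : Finset ι} (hS : S.card ≠ n) : koszulExtend R ι n f S = 0 :=
  Function.extend_apply' _ _ _ fun ⟨T, hT⟩ => hS (hT ▸ T.2)

theorem koszulExtend_koszulRestrict {R : Type u} [CommRing R] {ι : Type v} {n : ℕ}
    {F : Finset ι → R} (hF : ∀ S, S.card ≠ n → F S = 0) :
    koszulExtend R ι n (koszulRestrict R ι n F) = F := by
  funext S
  by_cases hS : S.card = n
  · exact Subtype.val_injective.extend_apply (koszulRestrict R ι n F) 0 ⟨S, hS⟩
  · rw [koszulExtend_apply_of_card_ne _ hS, hF S hS]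

theorem koszulD_koszulRestrict (r : ι → R) (n : ℕ) (F : Finset ι → R) :
    koszulD r n (koszulRestrict R ι (n + 1) F) = koszulRestrict R ι n (totalKoszulD r F) := by
  funext T
  exact (Finset.sum_subtype T.1ᶜ (fun _ => Finset.mem_compl)
    fun k => koszulSign R T.1 k * r k * F (insert k T.1)).symm

theorem totalKoszulD_koszulExtend_apply_of_card_ne (r : ι → R) {n : ℕ} (f : KoszulChain R ι n)
    {T : Finset ι} (hT : T.card + 1 ≠ n) : totalKoszulD r (koszulExtend R ι n f) T = 0 := by
  refine Finset.sum_eq_zero fun k hk => ?_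
  rw [koszulExtend_apply_of_card_ne f, mul_zero]
  rwa [Finset.card_insert_of_notMem (Finset.mem_compl.1 hk)]

theorem koszulExtend_koszulD (r : ι → R) (n : ℕ) (f : KoszulChain R ι (n + 1)) :
    koszulExtend R ι n (koszulD r n f) = totalKoszulD r (koszulExtend R ι (n + 1) f) := by
  nth_rw 1 [← koszulRestrict_koszulExtend f]
  rw [koszulD_koszulRestrict]
  exact koszulExtend_koszulRestrict fun T hT =>
    totalKoszulD_koszulExtend_apply_of_card_ne r f (Nat.succ_ne_succ_iff.2 hT)

theorem totalKoszulD_koszulExtend_zero (r : ι → R) (f : KoszulChain R ι 0) :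
    totalKoszulD r (koszulExtend R ι 0 f) = 0 :=
  funext fun _ => totalKoszulD_koszulExtend_apply_of_card_ne r f (Nat.succ_ne_zero _)

/-- Left exterior multiplication by `1_{j}` from Koszul `m`-chains to Koszul `n`-chains; this is the
expected map for `n = m + 1`, the other cases being junk that avoids casts between degrees. -/
noncomputable def koszulContraction (R : Type u) [CommRing R] {ι : Type v} [LinearOrder ι] (j : ι)
    (m n : ℕ) : KoszulChain R ι m →ₗ[R] KoszulChain R ι n :=
  koszulRestrict R ι n ∘ₗ koszulWedge R j ∘ₗ koszulExtend R ι m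

theorem koszulD_comp_koszulContraction_zero (r : ι → R) (j : ι) :
    koszulD r 0 ∘ₗ koszulContraction R j 0 1 = r j • LinearMap.id := by
  refine LinearMap.ext fun f => ?_
  have h := totalKoszulD_koszulWedge_add_koszulWedge_totalKoszulD r j (koszulExtend R ι 0 f)
  rw [totalKoszulD_koszulExtend_zero, map_zero, add_zero] at h
  simp only [koszulContraction, LinearMap.comp_apply, koszulD_koszulRestrict, h, map_smul,
    koszulRestrict_koszulExtend, LinearMap.smul_apply, LinearMap.id_apply]

theorem koszulContraction_comp_koszulD_add_koszulD_comp_koszulContraction (r : ι → R) (j : ι)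
    (n : ℕ) :
    koszulContraction R j n (n + 1) ∘ₗ koszulD r n +
      koszulD r (n + 1) ∘ₗ koszulContraction R j (n + 1) (n + 2) = r j • LinearMap.id := by
  refine LinearMap.ext fun f => ?_
  have h := totalKoszulD_koszulWedge_add_koszulWedge_totalKoszulD r j (koszulExtend R ι (n + 1) f)
  rw [add_comm] at h
  simp only [koszulContraction, LinearMap.add_apply, LinearMap.comp_apply, koszulD_koszulRestrict,
    koszulExtend_koszulD, ← map_add, h, map_smul, koszulRestrict_koszulExtend,
    LinearMap.smul_apply, LinearMap.id_apply]

end KoszulHomotopy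

section KoszulHomology

open CategoryTheory HomologicalComplex

variable {R : Type u} [CommRing R] {ι : Type v} [Fintype ι] [LinearOrder ι]

theorem koszulComplex_d (r : ι → R) (n : ℕ) :
    (koszulComplex r).d (n + 1) n = ModuleCat.ofHom (koszulD r n) :=
  ChainComplex.of_d (fun n => ModuleCat.of R (KoszulChain R ι n))
    (fun n => ModuleCat.ofHom (koszulD r n)) n

/-- Exterior multiplication by `1_{j}` as the family of maps underlying a homotopy of the Koszul
complex. -/
noncomputable def koszulHomotopyHom (r : ι → R) (j : ι) (m n : ℕ)
    (_ : (ComplexShape.down ℕ).Rel n m) : (koszulComplex r).X m ⟶ (koszulComplex r).X n :=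
  ModuleCat.ofHom (koszulContraction R j m n)

theorem nullHomotopicMap'_koszulHomotopyHom (r : ι → R) (j : ι) :
    Homotopy.nullHomotopicMap' (koszulHomotopyHom r j) = r j • 𝟙 (koszulComplex r) := by
  ext1 n
  cases n with
  | zero =>
    rw [Homotopy.nullHomotopicMap'_f_of_not_rel_left (k₁ := 1) rfl (by simp), koszulComplex_d]
    exact ModuleCat.hom_ext (koszulD_comp_koszulContraction_zero r j)
  | succ n =>
    rw [Homotopy.nullHomotopicMap'_f (k₂ := n + 2) (k₀ := n) rfl rfl, koszulComplex_d,
      koszulComplex_d]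
    exact ModuleCat.hom_ext
      (koszulContraction_comp_koszulD_add_koszulD_comp_koszulContraction r j n)

theorem homologicalComplex_homologyMap_smul {A C α : Type*} [CommRing A] [Category* C]
    [Preadditive C] [Linear A C] {c : ComplexShape α} {K L : HomologicalComplex C c} (a : A)
    (f : K ⟶ L) (i : α) [K.HasHomology i] [L.HasHomology i] :
    homologyMap (a • f) i = a • homologyMap f i :=
  ShortComplex.homologyMap_smul ((shortComplexFunctor C c i).map f) a

theorem smul_homology_koszulComplex_eq_zero (r : ι → R) (j : ι) (n : ℕ)
    (m : (koszulComplex r).homology n) : r j • m = 0 := by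
  have h := homologicalComplex_homologyMap_smul (r j) (𝟙 (koszulComplex r)) n
  rw [← nullHomotopicMap'_koszulHomotopyHom,
    (Homotopy.nullHomotopy' (koszulHomotopyHom r j)).homologyMap_eq n, homologyMap_zero,
    homologyMap_id] at h
  exact congrArg (fun f => f.hom m) h.symm

theorem span_range_le_annihilator_homology_koszulComplex (r : ι → R) (n : ℕ) :
    Ideal.span (Set.range r) ≤ Module.annihilator R ((koszulComplex r).homology n) := by
  rw [Ideal.span_le]
  rintro _ ⟨j, rfl⟩
  exact Module.mem_annihilator.2 (smul_homology_koszulComplex_eq_zero r j n)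

end KoszulHomology

section HomologyZero

open CategoryTheory Limits

/-- The homology in degree `0` of a chain complex is the cokernel of its last differential. -/
noncomputable def homologyZeroIsoCokernel {C : Type*} [Category* C] [Abelian C]
    (K : ChainComplex C ℕ) : K.homology 0 ≅ cokernel (K.d 1 0) :=
  K.isoHomologyι₀ ≪≫
    (K.opcyclesIsCokernel 1 0 (by simp)).coconePointUniqueUpToIso (colimit.isColimit _)

/-- A right exact functor commutes with the homology in degree `0`. -/
noncomputable def mapHomologyZeroIso {C D : Type*} [Category* C] [Category* D] [Abelian C]
    [Abelian D] (F : C ⥤ D) [F.Additive] [PreservesFiniteColimits F] (K : ChainComplex C ℕ) :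
    ((F.mapHomologicalComplex _).obj K).homology 0 ≅ F.obj (K.homology 0) :=
  homologyZeroIsoCokernel _ ≪≫ (PreservesCokernel.iso F (K.d 1 0)).symm ≪≫
    F.mapIso (homologyZeroIsoCokernel K).symm

open TensorProduct in
theorem annihilator_extendScalars_obj {R : Type u} {S : Type v} [CommRing R] [CommRing S]
    (φ : R →+* S) {I : Ideal R} {M : ModuleCat.{w} R} (e : M ≃ₗ[R] R ⧸ I) :
    Module.annihilator S ((ModuleCat.extendScalars.{u, v, w} φ).obj M) = I.map φ := by
  let := φ.toAlgebra
  have e' : S ⊗[R] M ≃ₗ[S] S ⧸ I.map φ := (e.baseChange R S _ _) ≪≫ₗ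
    (Algebra.TensorProduct.quotIdealMapEquivTensorQuot S I).symm.toLinearEquiv
  exact e'.annihilator_eq.trans Ideal.annihilator_quotient

variable {R : Type v} [CommRing R] {ι : Type u} [Fintype ι] [LinearOrder ι]

/-- The identification of a Koszul `0`-chain with its only coordinate, the one indexed by `∅`. -/
noncomputable def koszulChainZeroEquiv (R : Type v) [CommRing R] (ι : Type u) :
    KoszulChain R ι 0 ≃ₗ[R] R where
  __ := LinearMap.proj (R := R) (φ := fun _ => R) ⟨∅, rfl⟩
  invFun c _ := c
  left_inv f := funext fun S => congrArg f (Subtype.ext (Finset.card_eq_zero.1 S.2).symm)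
  right_inv _ := rfl

theorem koszulChainZeroEquiv_comp_koszulD (r : ι → R) :
    (koszulChainZeroEquiv R ι).toLinearMap ∘ₗ koszulD r 0 =
      Fintype.linearCombination R r ∘ₗ LinearMap.funLeft R R fun j => ⟨{j}, rfl⟩ := by
  refine LinearMap.ext fun f => ?_
  refine Fintype.sum_equiv (Equiv.subtypeUnivEquiv Finset.notMem_empty) _ _ fun j => ?_
  simp [mul_comm]

theorem map_range_koszulD_zero (r : ι → R) :
    (LinearMap.range (koszulD r 0)).map (koszulChainZeroEquiv R ι).toLinearMap =
      Ideal.span (Set.range r) := by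
  have hinj : Function.Injective fun j : ι => (⟨{j}, rfl⟩ : {S : Finset ι // S.card = 1}) :=
    fun i j hij => Finset.singleton_injective (congrArg Subtype.val hij)
  have hsurj := LinearMap.range_eq_top.2 (LinearMap.funLeft_surjective_of_injective R R _ hinj)
  rw [← LinearMap.range_comp, koszulChainZeroEquiv_comp_koszulD,
    LinearMap.range_comp_of_range_eq_top _ hsurj, Fintype.range_linearCombination]

/-- The homology in degree `0` of the Koszul complex of `r` is the quotient by the ideal that `r`
generates. -/
noncomputable def koszulHomologyZeroEquiv (r : ι → R) :
    (koszulComplex r).homology 0 ≃ₗ[R] R ⧸ Ideal.span (Set.range r) :=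
  (homologyZeroIsoCokernel _ ≪≫ ModuleCat.cokernelIsoRangeQuotient _).toLinearEquiv ≪≫ₗ
    Submodule.Quotient.equiv _ _ (koszulChainZeroEquiv R ι)
      (by rw [koszulComplex_d]; exact map_range_koszulD_zero r)

theorem annihilator_homology_zero_koszulComplex (r : ι → R) :
    Module.annihilator R ((koszulComplex r).homology 0) = Ideal.span (Set.range r) :=
  (koszulHomologyZeroEquiv r).annihilator_eq.trans Ideal.annihilator_quotient

theorem annihilator_homology_zero_extendScalars_koszulComplex {S : Type v} [CommRing S]
    (φ : R →+* S) (r : ι → R) :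
    Module.annihilator S (((ModuleCat.extendScalars.{v, v, max u v} φ).mapHomologicalComplex
      _).obj (koszulComplex r) |>.homology 0) = (Ideal.span (Set.range r)).map φ := by
  rw [(mapHomologyZeroIso _ _).toLinearEquiv.annihilator_eq]
  exact annihilator_extendScalars_obj φ (koszulHomologyZeroEquiv r)

end HomologyZero

theorem annOver_eq_comap_annihilator {A : Type u} {R : Type v} [CommRing A] [CommRing R]
    (φ : A →+* R) (M : Type w) [AddCommGroup M] [Module R M] :
    annOver φ M = (Module.annihilator R M).comap φ :=
  Ideal.ext fun _ => Module.mem_annihilator.symm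

namespace DirectedGraph

variable {V : Type u} {E : Type v} [Fintype V] [DecidableEq V] [Fintype E]
  (G : DirectedGraph V E) [LinearOrder G.RelationIndex] (x : E)

theorem annihilator_KRHomology_zero :
    Module.annihilator _ (G.KRHomology 0) = G.incidenceIdeal :=
  annihilator_homology_zero_koszulComplex G.relations

theorem annihilator_KRHomologyRatZero :
    Module.annihilator _ G.KRHomologyRatZero =
      G.incidenceIdeal.map (MvPolynomial.map (Int.castRingHom ℚ)) :=
  annihilator_homology_zero_extendScalars_koszulComplex _ G.relations

theorem annihilator_TotalKRHomology :
    Module.annihilator _ G.TotalKRHomology = G.incidenceIdeal := by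
  refine le_antisymm ?_ fun a ha => Module.mem_annihilator.2 fun m => ?_
  · rw [← G.annihilator_KRHomology_zero]
    exact LinearMap.annihilator_le_of_injective
      (DirectSum.lof (MvPolynomial E ℤ) ℕ (fun n => G.KRHomology n) 0) (DirectSum.of_injective 0)
  · refine DFinsupp.ext fun n => ?_
    exact Module.mem_annihilator.1
      (span_range_le_annihilator_homology_koszulComplex G.relations n ha) (m n)

theorem annOver_KRHomology_zero :
    annOver (edgeInclusion ℤ x) (G.KRHomology 0) = G.contractedIdeal ℤ x := by
  rw [annOver_eq_comap_annihilator, annihilator_KRHomology_zero, contractedIdeal_int]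

theorem annOver_TotalKRHomology :
    annOver (edgeInclusion ℤ x) G.TotalKRHomology = G.contractedIdeal ℤ x := by
  rw [annOver_eq_comap_annihilator, annihilator_TotalKRHomology, contractedIdeal_int]

theorem annOver_KRHomologyRatZero :
    annOver (edgeInclusion ℚ x) G.KRHomologyRatZero = G.contractedIdeal ℚ x := by
  rw [annOver_eq_comap_annihilator, annihilator_KRHomologyRatZero, contractedIdeal]

variable {G x}

theorem KdimOver_KRHomology_zero_of_hasCycleThrough (hx : G.HasCycleThrough x) :
    KdimOver (edgeInclusion ℤ x) (G.KRHomology 0) = 2 := by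
  rw [KdimOver, annOver_KRHomology_zero,
    ringKrullDim_quotient_contractedIdeal_of_hasCycleThrough ℤ hx,
    IsPrincipalIdealRing.ringKrullDim_eq_one ℤ Int.not_isField, one_add_one_eq_two]

theorem KdimOver_KRHomology_zero_of_not_hasCycleThrough (hx : ¬ G.HasCycleThrough x) :
    KdimOver (edgeInclusion ℤ x) (G.KRHomology 0) = 1 := by
  rw [KdimOver, annOver_KRHomology_zero,
    ringKrullDim_quotient_contractedIdeal_of_not_hasCycleThrough ℤ hx,
    IsPrincipalIdealRing.ringKrullDim_eq_one ℤ Int.not_isField]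

theorem KdimOver_KRHomology_zero_eq_one_iff :
    KdimOver (edgeInclusion ℤ x) (G.KRHomology 0) = 1 ↔ ¬ G.HasCycleThrough x := by
  refine ⟨fun h hx => ?_, KdimOver_KRHomology_zero_of_not_hasCycleThrough⟩
  rw [KdimOver_KRHomology_zero_of_hasCycleThrough hx] at h
  exact absurd h (by decide)

theorem KdimOver_KRHomologyRatZero_of_hasCycleThrough (hx : G.HasCycleThrough x) :
    KdimOver (edgeInclusion ℚ x) G.KRHomologyRatZero = 1 := by
  rw [KdimOver, annOver_KRHomologyRatZero,
    ringKrullDim_quotient_contractedIdeal_of_hasCycleThrough ℚ hx, ringKrullDim_eq_zero_of_field,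
    zero_add]

theorem KdimOver_KRHomologyRatZero_of_not_hasCycleThrough (hx : ¬ G.HasCycleThrough x) :
    KdimOver (edgeInclusion ℚ x) G.KRHomologyRatZero = 0 := by
  rw [KdimOver, annOver_KRHomologyRatZero,
    ringKrullDim_quotient_contractedIdeal_of_not_hasCycleThrough ℚ hx,
    ringKrullDim_eq_zero_of_field]

theorem KdimOver_KRHomologyRatZero_eq_zero_iff :
    KdimOver (edgeInclusion ℚ x) G.KRHomologyRatZero = 0 ↔ ¬ G.HasCycleThrough x := by
  refine ⟨fun h hx => ?_, KdimOver_KRHomologyRatZero_of_not_hasCycleThrough⟩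
  rw [KdimOver_KRHomologyRatZero_of_hasCycleThrough hx] at h
  exact one_ne_zero h

end DirectedGraph

theorem mainTheorem7 {V : Type u} {E : Type v} [Fintype V] [DecidableEq V] [Fintype E]
    (G : DirectedGraph V E) [LinearOrder G.RelationIndex] (x : E) :
    List.TFAE [
      ¬ G.HasCycleThrough x,
      Module.Finite ℤ (Polynomial ℤ ⧸ annOver (edgeInclusion ℤ x) (G.KRHomology 0)),
      Module.Finite ℤ (Polynomial ℤ ⧸ annOver (edgeInclusion ℤ x) G.TotalKRHomology),
      ∃ n : ℕ, 1 ≤ n ∧ (MvPolynomial.X x : MvPolynomial E ℤ) ^ n ∈ G.incidenceIdeal,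
      KdimOver (edgeInclusion ℤ x) (G.KRHomology 0) = 1,
      KdimOver (edgeInclusion ℚ x) G.KRHomologyRatZero = 0] ∧
    (G.HasCycleThrough x ↔
      KdimOver (edgeInclusion ℤ x) (G.KRHomology 0) =
        KdimOver (edgeInclusion ℚ x) G.KRHomologyRatZero + 1 ∧
      KdimOver (edgeInclusion ℚ x) G.KRHomologyRatZero = 1) := by
  constructor
  · tfae_have 2 ↔ 1 := by
      rw [G.annOver_KRHomology_zero]
      exact DirectedGraph.finite_quotient_contractedIdeal_iff
    tfae_have 3 ↔ 1 := by
      rw [G.annOver_TotalKRHomology]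
      exact DirectedGraph.finite_quotient_contractedIdeal_iff
    tfae_have 4 ↔ 1 := by
      simp only [← DirectedGraph.X_pow_mem_contractedIdeal_int,
        DirectedGraph.exists_X_pow_mem_contractedIdeal_iff]
    tfae_have 5 ↔ 1 := DirectedGraph.KdimOver_KRHomology_zero_eq_one_iff
    tfae_have 6 ↔ 1 := DirectedGraph.KdimOver_KRHomologyRatZero_eq_zero_iff
    tfae_finish
  · refine ⟨fun hx => ?_, fun ⟨_, h⟩ => ?_⟩
    · rw [DirectedGraph.KdimOver_KRHomology_zero_of_hasCycleThrough hx,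
        DirectedGraph.KdimOver_KRHomologyRatZero_of_hasCycleThrough hx, one_add_one_eq_two]
      exact ⟨rfl, rfl⟩
    · by_contra hx
      rw [DirectedGraph.KdimOver_KRHomologyRatZero_of_not_hasCycleThrough hx] at h
      exact zero_ne_one h
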